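/- **Model.** Let $U$ be a finite set of $n$ users, $\Delta$ a finite set of destinations and $b\in[0,1]$. A configuration $C$ consists of a destination $C_D(v)\in\Delta$ and indicators $C_I(v),C_O(v)\in\{0,1\}$ ("input observed", "output observed") for every user $v$. In the random configuration $X$ all these choices are independent: $X_D(v)$ has a given distribution $p^v=(p^v_\delta)_{\delta\in\Delta}$, and $X_I(v)$ and $X_O(v)$ each equal $1$ with probability $b$. For each user $v$ the adversary receives one message: $(\bot,\bot)$, $(v,\bot)$, $(\bot,C_D(v))$ or $(v,C_D(v))$, where the first entry is revealed iff $C_I(v)=1$ and the second iff $C_O(v)=1$. Write $C\approx C'$ if the multisets of the $n$ messages received in $C$ and in $C'$ are equal. For a user $u$ and a destination $d$ with $p^u_d>0$ put $\Psi(C)=\Pr[X_D(u)=d\mid X\approx C]$. **Theorem.** Fix $b\in[0,1]$, the set $\Delta$, the distribution $p^u$ of the user $u$, a destination $d$ with $p^u_d>0$, and a number $\alpha$. Order the destinations as $d=d_1,d_2,\ldots,d_{|\Delta|}$ so that $p^u_{d_i}\ge p^u_{d_{i+1}}$ for all $i>1$. Assume that every user $v\ne u$ has $p^v_d=1$ or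 $p^v_{d_{|\Delta|}}=1$, and that $|\{v\neq u: p^v_d=1\}|/(n-1)=\alpha$, where $n\ge 2$. Then, if $\alpha=0$, $$E[\Psi\mid X_D(u)=d]=b(1-b)p^u_d+b^2+(1-b)\left(b+\frac{(1-b)^2p^u_d}{1-b+p^u_{d_{|\Delta|}}b}\right)+O\!\left(\sqrt{\frac{\log n}{n}}\right);$$ if $0<\alpha<1$, $$E[\Psi\mid X_D(u)=d]=b(1-b)p^u_d+b^2+(1-b)\frac{p^u_d}{1-b+p^u_db+p^u_{d_{|\Delta|}}b}+O\!\left(\sqrt{\frac{\log n}{n}}\right);$$ and if $\alpha=1$, $$E[\Psi\mid X_D(u)=d]=b(1-b)p^u_d+b^2+(1-b)\frac{p^u_d}{1-b+p^u_db}+O\!\left(\sqrt{\frac{\log n}{n}}\right).$$ (If $b=1$, the terms with the prefactor $1-b$ are read as $0$.) The constant in $O(\cdot)$ depends only on $b$, $\Delta$, $p^u$, the ordering $d=d_1,\ldots,d_{|\Delta|}$ and $\alpha$; the bound holds for all $n\ge2$, all $U$ with $|U|=n$, all $u\in U$ and all $(p^v)_{v\ne u}$ as above. -/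

import Mathlib

noncomputable section

namespace OnionRouting

/-- A configuration assigns to every user a circuit: the chosen destination, whether the user's
input is observed, and whether the user's output is observed. -/
abbrev Configuration (U Δ : Type*) := U → Δ × Bool × Bool

/-- The destination `C_D(v)`. -/
def Configuration.dest {U Δ : Type*} (C : Configuration U Δ) (v : U) : Δ := (C v).1

/-- The indicator `C_I(v)`: the input of `v` is observed. -/
def Configuration.input {U Δ : Type*} (C : Configuration U Δ) (v : U) : Bool := (C v).2.1

/-- The indicator `C_O(v)`: the output of `v` is observed. -/
def Configuration.output {U Δ : Type*} (C : Configuration U Δ) (v : U) : Bool := (C v).2.2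

/-- The message that the adversary receives about the connection of `v`:
one of `(⊥, ⊥)`, `(v, ⊥)`, `(⊥, C_D(v))`, `(v, C_D(v))`. -/
def message {U Δ : Type*} (C : Configuration U Δ) (v : U) : Option U × Option Δ :=
  (if C.input v then some v else none, if C.output v then some (C.dest v) else none)

/-- All that the adversary receives: the unordered collection (with multiplicities) of the
messages about all connections. -/
def observation {U Δ : Type*} [Fintype U] (C : Configuration U Δ) :
    Multiset (Option U × Option Δ) :=
  (Finset.univ : Finset U).val.map (message C)

/-- `C ≈ C'`: the adversary receives the same in both configurations. -/
def Indistinguishable {U Δ : Type*} [Fintype U] (C C' : Configuration U Δ) : Prop :=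
  observation C = observation C'

/-- The probability of an observation indicator: `1` with probability `b`, else `0`. -/
def bernoulliWeight (b : ℝ) (x : Bool) : ℝ := if x then b else 1 - b

/-- `Pr[X = C]`: all destinations and all observation indicators are independent, the
destination of `v` has law `p v`, and each input and each output is observed with
probability `b`. -/
def configProb {U Δ : Type*} [Fintype U] (b : ℝ) (p : U → Δ → ℝ)
    (C : Configuration U Δ) : ℝ :=
  ∏ v, p v (C.dest v) * bernoulliWeight b (C.input v) * bernoulliWeight b (C.output v)

open Classical in
/-- `Pr[X ∈ E]`. -/
def prob {U Δ : Type*} [Fintype U] [Fintype Δ] (b : ℝ) (p : U → Δ → ℝ)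
    (E : Set (Configuration U Δ)) : ℝ :=
  ∑ C : Configuration U Δ with C ∈ E, configProb b p C

/-- `Pr[X ∈ E | X ∈ F]`. -/
def condProb {U Δ : Type*} [Fintype U] [Fintype Δ] (b : ℝ) (p : U → Δ → ℝ)
    (E F : Set (Configuration U Δ)) : ℝ :=
  prob b p (E ∩ F) / prob b p F

open Classical in
/-- `E[f(X) | X ∈ F]`. -/
def condExpect {U Δ : Type*} [Fintype U] [Fintype Δ] (b : ℝ) (p : U → Δ → ℝ)
    (f : Configuration U Δ → ℝ) (F : Set (Configuration U Δ)) : ℝ :=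
  (∑ C : Configuration U Δ with C ∈ F, configProb b p C * f C) / prob b p F

/-- The event `X_D(u) = d`. -/
def destEvent {U Δ : Type*} (u : U) (d : Δ) : Set (Configuration U Δ) := {C | C.dest u = d}

/-- The posterior probability `Ψ(C) = Pr[X_D(u) = d | X ≈ C]`. -/
def posterior {U Δ : Type*} [Fintype U] [Fintype Δ] (b : ℝ) (p : U → Δ → ℝ)
    (u : U) (d : Δ) (C : Configuration U Δ) : ℝ :=
  condProb b p (destEvent u d) {C' | Indistinguishable C' C}

/-- `E[Ψ | X_D(u) = d]`. -/
def expectedPosterior {U Δ : Type*} [Fintype U] [Fintype Δ] (b : ℝ) (p : U → Δ → ℝ)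
    (u : U) (d : Δ) : ℝ :=
  condExpect b p (posterior b p u d) (destEvent u d)

open Classical in
/-- The fraction of the users other than `u` that always visit `d`. -/
def fractionAlways {U Δ : Type*} [Fintype U] (p : U → Δ → ℝ) (u : U) (d : Δ) : ℝ :=
  (Finset.card {v : U | v ≠ u ∧ p v d = 1} : ℝ) / ((Fintype.card U : ℝ) - 1)

end OnionRouting

end

/-!
Conditionally on `X_D(u) = d`, the two indicators of `u` have probabilities not depending on the
other users, and `Ψ` is computed separately in each case. If `u` is linked, `Ψ = 1`; if only its
input is observed, the observation does not depend on its destination and `Ψ` is the prior. These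
cases contribute `b ^ 2` and `b * (1 - b) * p u d`, without error.

Suppose the input of `u` is not observed. Cut the observation class of a configuration `C₀` into
cells according to the circuit of `u` (`cellProb`). The cells in which the output of `u` is hidden
have probabilities proportional to the prior (`cellProb_false_eq`). The cell in which `u` is seen
at `x` is compared with the one in which it visits `x` unseen by switching: exchanging the circuits
of `u` and of a user who always visits `x`, with hidden input and with the opposite output
indicator, preserves both the probability and the observation. Let `N` and `Z` count the users
other than `u` that always visit `x` with hidden input and with hidden, respectively observed,
output. The numbers of unlinked exits to `x` and of hidden inputs are functions of the observation,
so `N` and `Z` are constant on each of the two cells, up to null configurations. With `N` and `Z`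
counted in `C₀`, double counting gives (`cellProb_mul_switch`)
`cell(x, seen) * (N + 1 - e) = cell(x, unseen) * (Z + e)`,
where `e` is `1` if `u` is seen at `x` in `C₀` and `0` otherwise.

If a positive fraction of the users always visits `x`, then `Z / N` is close to `b / (1 - b)`, so
the ratio of the two cells is `b : 1 - b` up to the deviations of `N` and `Z` from their means,
divided by `n` (`unlinkedMean_mul_abs_le`). If nobody else visits `x`, the identity holds with
`N = Z = 0` and determines the cell exactly. Inserting this into the quotient of cells that is `Ψ`
gives the three main terms. The deviations are sums of independent centred variables, so their
expected absolute values are at most `√n` (`sum_configProb_mul_abs_le`), and the total error is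
`O(1 / √n)`, which is better than what is claimed.
-/

namespace OnionRouting

open Finset

/-! ### Independence and concentration -/

section

open Classical

variable {U Δ : Type*} [Fintype U] [Fintype Δ] {b : ℝ} {p : U → Δ → ℝ}

/-- The probability that a single user with destination distribution `q` has the circuit `s`. -/
def circuitWeight (b : ℝ) (q : Δ → ℝ) (s : Δ × Bool × Bool) : ℝ :=
  q s.1 * bernoulliWeight b s.2.1 * bernoulliWeight b s.2.2

lemma configProb_eq_prod {U Δ : Type*} [Fintype U] {b : ℝ} {p : U → Δ → ℝ}
    (C : Configuration U Δ) :
    configProb b p C = ∏ v, circuitWeight b (p v) (C v) := rfl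

lemma bernoulliWeight_nonneg (hb0 : 0 ≤ b) (hb1 : b ≤ 1) (x : Bool) :
    0 ≤ bernoulliWeight b x := by
  cases x <;> simp [bernoulliWeight] <;> linarith

lemma bernoulliWeight_le_one (hb0 : 0 ≤ b) (hb1 : b ≤ 1) (x : Bool) :
    bernoulliWeight b x ≤ 1 := by
  cases x <;> simp [bernoulliWeight] <;> linarith

lemma circuitWeight_nonneg (hb0 : 0 ≤ b) (hb1 : b ≤ 1) {q : Δ → ℝ} (hq : q ∈ stdSimplex ℝ Δ)
    (s : Δ × Bool × Bool) : 0 ≤ circuitWeight b q s :=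
  mul_nonneg (mul_nonneg (hq.1 _) (bernoulliWeight_nonneg hb0 hb1 _))
    (bernoulliWeight_nonneg hb0 hb1 _)

lemma sum_circuitWeight {q : Δ → ℝ} (hq : q ∈ stdSimplex ℝ Δ) :
    ∑ s, circuitWeight b q s = 1 := by
  have h : ∀ x, ∑ y : Bool × Bool, circuitWeight b q (x, y) = q x := by
    intro x
    simp [Fintype.sum_prod_type, circuitWeight, bernoulliWeight]
    ring
  rw [Fintype.sum_prod_type]
  simp only [h]
  exact hq.2

lemma configProb_nonneg (hb0 : 0 ≤ b) (hb1 : b ≤ 1) (hp : ∀ v, p v ∈ stdSimplex ℝ Δ)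
    (C : Configuration U Δ) : 0 ≤ configProb b p C :=
  prod_nonneg fun v _ => circuitWeight_nonneg hb0 hb1 (hp v) (C v)

/-- Independence: the expectation of a product of functions of single circuits is the product of
the expectations. -/
lemma sum_configProb_mul_prod (h : U → Δ × Bool × Bool → ℝ) :
    ∑ C : Configuration U Δ, configProb b p C * ∏ v, h v (C v) =
      ∏ v, ∑ s, circuitWeight b (p v) s * h v s := by
  simp only [configProb_eq_prod, ← prod_mul_distrib]
  rw [prod_univ_sum, Fintype.piFinset_univ]

lemma sum_configProb_mul_apply (hp : ∀ v, p v ∈ stdSimplex ℝ Δ) (v : U)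
    (f : Δ × Bool × Bool → ℝ) :
    ∑ C : Configuration U Δ, configProb b p C * f (C v) =
      ∑ s, circuitWeight b (p v) s * f s := by
  have h := sum_configProb_mul_prod (b := b) (p := p) (fun w s => if w = v then f s else 1)
  rw [prod_eq_single v (fun w _ hw => by simp [hw, sum_circuitWeight (hp w)]) (by simp)] at h
  simpa using h

lemma sum_configProb_mul_apply_mul_apply (hp : ∀ v, p v ∈ stdSimplex ℝ Δ) {v w : U} (hvw : v ≠ w)
    (f g : Δ × Bool × Bool → ℝ) :
    ∑ C : Configuration U Δ, configProb b p C * (f (C v) * g (C w)) =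
      (∑ s, circuitWeight b (p v) s * f s) * ∑ s, circuitWeight b (p w) s * g s := by
  have h := sum_configProb_mul_prod (b := b) (p := p)
    (fun z s => (if z = v then f s else 1) * (if z = w then g s else 1))
  rw [prod_eq_mul v w hvw (fun z _ hz => by simp [hz.1, hz.2, sum_circuitWeight (hp z)])
    (by simp) (by simp)] at h
  simp only [prod_mul_distrib, prod_ite_eq', mem_univ, if_true] at h
  simpa [hvw, hvw.symm] using h

lemma sum_configProb (hp : ∀ v, p v ∈ stdSimplex ℝ Δ) :
    ∑ C : Configuration U Δ, configProb b p C = 1 := by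
  have h := sum_configProb_mul_prod (b := b) (p := p) (fun _ _ => 1)
  simpa [sum_circuitWeight (hp _)] using h

/-- A sum of centred functions of distinct circuits, each bounded by `1`, has variance at most the
number of summands. -/
lemma sum_configProb_mul_sq_le (hb0 : 0 ≤ b) (hb1 : b ≤ 1) (hp : ∀ v, p v ∈ stdSimplex ℝ Δ)
    (V : Finset U) (g : Δ × Bool × Bool → ℝ) (hg : ∀ s, |g s| ≤ 1)
    (hg0 : ∀ v ∈ V, ∑ s, circuitWeight b (p v) s * g s = 0) :
    ∑ C : Configuration U Δ, configProb b p C * (∑ v ∈ V, g (C v)) ^ 2 ≤ #V := by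
  have hexp : ∀ C : Configuration U Δ, configProb b p C * (∑ v ∈ V, g (C v)) ^ 2 =
      ∑ v ∈ V, ∑ w ∈ V, configProb b p C * (g (C v) * g (C w)) := by
    intro C
    rw [sq, sum_mul_sum, mul_sum]
    simp only [mul_sum]
  simp only [hexp]
  rw [sum_comm, card_eq_sum_ones, Nat.cast_sum]
  refine sum_le_sum fun v hv => ?_
  rw [sum_comm, sum_eq_single v]
  · calc ∑ C : Configuration U Δ, configProb b p C * (g (C v) * g (C v))
        ≤ ∑ C : Configuration U Δ, configProb b p C * 1 := by
          refine sum_le_sum fun C _ =>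
            mul_le_mul_of_nonneg_left ?_ (configProb_nonneg hb0 hb1 hp C)
          rw [← abs_mul_abs_self]
          exact mul_le_one₀ (hg _) (abs_nonneg _) (hg _)
      _ = _ := by simp [sum_configProb hp]
  · intro w _ hwv
    rw [sum_configProb_mul_apply_mul_apply hp hwv.symm, hg0 v hv, zero_mul]
  · exact fun h => absurd hv h

lemma sum_configProb_mul_abs_le (hb0 : 0 ≤ b) (hb1 : b ≤ 1) (hp : ∀ v, p v ∈ stdSimplex ℝ Δ)
    (V : Finset U) (g : Δ × Bool × Bool → ℝ) (hg : ∀ s, |g s| ≤ 1)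
    (hg0 : ∀ v ∈ V, ∑ s, circuitWeight b (p v) s * g s = 0) {n : ℝ} (hn : 0 < n)
    (hV : (#V : ℝ) ≤ n) :
    ∑ C : Configuration U Δ, configProb b p C * |∑ v ∈ V, g (C v)| ≤ √n := by
  have hs : 0 < √n := Real.sqrt_pos.2 hn
  -- AM-GM replaces the Cauchy-Schwarz inequality
  have hpt : ∀ C : Configuration U Δ, configProb b p C * |∑ v ∈ V, g (C v)| ≤
      (configProb b p C * (∑ v ∈ V, g (C v)) ^ 2) / (2 * √n) + configProb b p C * (√n / 2) := by
    intro C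
    set S := ∑ v ∈ V, g (C v)
    have h : |S| ≤ S ^ 2 / (2 * √n) + √n / 2 := by
      rw [div_add_div _ _ (by positivity) (by norm_num), le_div_iff₀ (by positivity)]
      nlinarith [sq_nonneg (|S| - √n), sq_abs S]
    have h2 := mul_le_mul_of_nonneg_left h (configProb_nonneg hb0 hb1 hp C)
    rw [mul_add, ← mul_div_assoc] at h2
    exact h2
  refine (sum_le_sum fun C _ => hpt C).trans ?_
  rw [sum_add_distrib, ← sum_div, ← sum_mul, sum_configProb hp]
  have hvar := (sum_configProb_mul_sq_le hb0 hb1 hp V g hg hg0).trans hV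
  have : (∑ C : Configuration U Δ, configProb b p C * (∑ v ∈ V, g (C v)) ^ 2) / (2 * √n) ≤
      √n / 2 := by
    rw [div_le_iff₀ (by positivity)]
    nlinarith [Real.mul_self_sqrt hn.le]
  linarith

end

/-! ### What the adversary's observation determines -/

section

open Classical

variable {U Δ : Type*} [Fintype U]

lemma message_eq_cond {U Δ : Type*} (C : Configuration U Δ) (v : U) :
    message C v =
      (bif (C v).2.1 then some v else none, bif (C v).2.2 then some (C v).1 else none) := by
  obtain ⟨y, i, o, hC⟩ : ∃ y i o, C v = (y, i, o) := ⟨_, _, _, rfl⟩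
  cases i <;> cases o <;>
    simp [message, Configuration.input, Configuration.output, Configuration.dest, hC]

lemma mem_observation {C : Configuration U Δ} {x : Option U × Option Δ} :
    x ∈ observation C ↔ ∃ v, message C v = x := by
  simp [observation]

lemma message_fst_eq_some {U Δ : Type*} {C : Configuration U Δ} {v w : U} :
    (message C w).1 = some v ↔ C.input w = true ∧ w = v := by
  simp only [message]
  split_ifs with h <;> simp [h]

lemma Indistinguishable.message_eq {C C' : Configuration U Δ} (h : Indistinguishable C C') {v : U}
    (hv : C.input v = true) : message C' v = message C v := by
  have hmem : message C v ∈ observation C' := h ▸ mem_observation.2 ⟨v, rfl⟩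
  obtain ⟨w, hw⟩ := mem_observation.1 hmem
  have : (message C' w).1 = some v := by rw [hw]; exact message_fst_eq_some.2 ⟨hv, rfl⟩
  obtain ⟨-, rfl⟩ := message_fst_eq_some.1 this
  exact hw

lemma Indistinguishable.input_eq {C C' : Configuration U Δ} (h : Indistinguishable C C') (v : U) :
    C'.input v = C.input v := by
  have key : ∀ {C C' : Configuration U Δ}, Indistinguishable C C' → C.input v = true →
      C'.input v = true := fun h hv =>
    (message_fst_eq_some.1 (h.message_eq hv ▸ message_fst_eq_some.2 ⟨hv, rfl⟩)).1
  rw [Bool.eq_iff_iff]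
  exact ⟨key (Eq.symm h), key h⟩

lemma Indistinguishable.output_eq {C C' : Configuration U Δ} (h : Indistinguishable C C') {v : U}
    (hv : C.input v = true) : C'.output v = C.output v := by
  have := congrArg (fun x => x.2.isSome) (h.message_eq hv)
  simp only [message] at this
  revert this
  cases C'.output v <;> cases C.output v <;> simp

lemma Indistinguishable.dest_eq {C C' : Configuration U Δ} (h : Indistinguishable C C') {v : U}
    (hv : C.input v = true) (ho : C.output v = true) : C'.dest v = C.dest v := by
  have := congrArg Prod.snd (h.message_eq hv)
  simpa [message, ho, h.output_eq hv] using this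

/-- The number of unlinked exits to `x`, i.e. of users whose output but not input is observed
and who visit `x`, is determined by the observation. -/
lemma Indistinguishable.card_exit_eq {C C' : Configuration U Δ} (h : Indistinguishable C C')
    (x : Δ) : #{v | C' v = (x, false, true)} = #{v | C v = (x, false, true)} := by
  have key : ∀ C : Configuration U Δ,
      (observation C).count (none, some x) = #{v | C v = (x, false, true)} := by
    intro C
    rw [observation, Multiset.count_map, Finset.card_def, Finset.filter_val]
    congr 1
    refine Multiset.filter_congr fun v _ => ?_
    obtain ⟨y, i, o, hC⟩ : ∃ y i o, C v = (y, i, o) := ⟨_, _, _, rfl⟩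
    cases i <;> cases o <;> simp [message_eq_cond, hC, eq_comm]
  rw [← key, ← key, h]

lemma observation_comp_swap {C : Configuration U Δ} {u v : U}
    (hu : C.input u = false) (hv : C.input v = false) :
    observation (C ∘ Equiv.swap u v) = observation C := by
  have hmsg : ∀ w, message (C ∘ Equiv.swap u v) w = message C (Equiv.swap u v w) := by
    intro w
    have hu' : (C u).2.1 = false := hu
    have hv' : (C v).2.1 = false := hv
    by_cases h1 : w = u
    · subst h1
      simp [message_eq_cond, hv']
    by_cases h2 : w = v
    · subst h2
      simp [message_eq_cond, hu']
    simp [message_eq_cond, Equiv.swap_apply_of_ne_of_ne h1 h2]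
  have : message (C ∘ Equiv.swap u v) = message C ∘ Equiv.swap u v := funext hmsg
  rw [observation, observation, this, ← Multiset.map_map]
  congr 1
  exact congrArg Finset.val (Finset.map_univ_equiv (Equiv.swap u v))

lemma observation_update {C : Configuration U Δ} {u : U} {x : Δ}
    (ho : C.output u = false) :
    observation (Function.update C u (x, C.input u, false)) = observation C := by
  rw [observation, observation]
  congr 1
  funext w
  by_cases h : w = u
  · subst h
    have ho' : (C w).2.2 = false := ho
    simp [message_eq_cond, Configuration.input, ho']
  · simp [message_eq_cond, h]

end

/-! ### Cells of an observation class and the switching identity -/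

noncomputable section

open Classical

variable {U Δ : Type*} [Fintype U] [Fintype Δ] {b : ℝ} {p : U → Δ → ℝ}

/-- `Pr[X ≈ C₀, X(u) = s]`: the part of the observation class of `C₀` in which `u` has the
circuit `s`. -/
def cellProb (b : ℝ) (p : U → Δ → ℝ) (u : U) (C₀ : Configuration U Δ) (s : Δ × Bool × Bool) : ℝ :=
  ∑ C : Configuration U Δ with Indistinguishable C C₀ ∧ C u = s, configProb b p C

/-- The users other than `u` that always visit `x`. -/
def alwaysVisit (p : U → Δ → ℝ) (u : U) (x : Δ) : Finset U := {v | v ≠ u ∧ p v x = 1}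

/-- The number of users other than `u` that always visit `x`, whose input is not observed in `C`,
and whose output is observed or not according to `o`. -/
def unlinkedCount (p : U → Δ → ℝ) (u : U) (x : Δ) (o : Bool) (C : Configuration U Δ) : ℕ :=
  #{v ∈ alwaysVisit p u x | C v = (x, false, o)}

lemma cellProb_nonneg (hb0 : 0 ≤ b) (hb1 : b ≤ 1) (hp : ∀ v, p v ∈ stdSimplex ℝ Δ)
    (u : U) (C₀ : Configuration U Δ) (s : Δ × Bool × Bool) : 0 ≤ cellProb b p u C₀ s :=
  sum_nonneg fun C _ => configProb_nonneg hb0 hb1 hp C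

lemma configProb_le_cellProb (hb0 : 0 ≤ b) (hb1 : b ≤ 1) (hp : ∀ v, p v ∈ stdSimplex ℝ Δ)
    (u : U) (C₀ : Configuration U Δ) : configProb b p C₀ ≤ cellProb b p u C₀ (C₀ u) :=
  single_le_sum (f := configProb b p) (fun C _ => configProb_nonneg hb0 hb1 hp C)
    (mem_filter.2 ⟨mem_univ _, rfl, rfl⟩)

lemma cellProb_eq_zero {u : U} {C₀ : Configuration U Δ} {s : Δ × Bool × Bool}
    (h : ∀ C, configProb b p C ≠ 0 → Indistinguishable C C₀ → C u ≠ s) :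
    cellProb b p u C₀ s = 0 := by
  refine sum_eq_zero fun C hC => ?_
  by_contra hne
  exact h C hne (mem_filter.1 hC).2.1 (mem_filter.1 hC).2.2

lemma prob_eq_sum_filter {E : Set (Configuration U Δ)} {q : Configuration U Δ → Prop}
    [DecidablePred q] (h : ∀ C, C ∈ E ↔ q C) :
    prob b p E = ∑ C : Configuration U Δ with q C, configProb b p C := by
  rw [prob]
  exact sum_congr (Finset.filter_congr fun C _ => h C) fun _ _ => rfl

lemma posterior_eq_div (u : U) (d : Δ) (C₀ : Configuration U Δ) :
    posterior b p u d C₀ =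
      (∑ y, cellProb b p u C₀ (d, y)) / ∑ x, ∑ y, cellProb b p u C₀ (x, y) := by
  have hcell : ∀ x, ∑ y, cellProb b p u C₀ (x, y) =
      ∑ C : Configuration U Δ with Indistinguishable C C₀ ∧ C.dest u = x, configProb b p C := by
    intro x
    simp only [cellProb, sum_filter]
    rw [sum_comm]
    refine sum_congr rfl fun C _ => ?_
    obtain ⟨z, w, hC⟩ : ∃ z w, C u = (z, w) := ⟨_, _, rfl⟩
    by_cases h1 : Indistinguishable C C₀ <;> by_cases h2 : z = x <;>
      simp [h1, h2, hC, Configuration.dest]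
  rw [posterior, condProb]
  congr 1
  · rw [hcell, prob_eq_sum_filter (E := destEvent u d ∩ {C' | Indistinguishable C' C₀})
      (q := fun C => Indistinguishable C C₀ ∧ C.dest u = d) fun C => and_comm]
  · rw [prob_eq_sum_filter (E := {C' | Indistinguishable C' C₀})
      (q := fun C => Indistinguishable C C₀) fun C => Iff.rfl]
    simp only [hcell, sum_filter]
    rw [sum_comm]
    refine sum_congr rfl fun C _ => ?_
    by_cases h1 : Indistinguishable C C₀ <;> simp [h1]

/-- If the output of `u` is not observed, the observation carries no information about the
destination of `u`. -/
lemma cellProb_mul_comm (u : U) (C₀ : Configuration U Δ) (i : Bool) (x y : Δ) :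
    cellProb b p u C₀ (x, i, false) * p u y = cellProb b p u C₀ (y, i, false) * p u x := by
  have hmem : ∀ x y : Δ, ∀ C : Configuration U Δ,
      Indistinguishable C C₀ ∧ C u = (x, i, false) →
      Indistinguishable (Function.update C u (y, i, false)) C₀ := by
    intro x y C ⟨h1, h2⟩
    have hi : C.input u = i := by simp [Configuration.input, h2]
    have ho : C.output u = false := by simp [Configuration.output, h2]
    rw [← hi]
    exact (observation_update ho).trans h1
  rw [cellProb, cellProb, sum_mul, sum_mul]
  refine sum_nbij' (fun C => Function.update C u (y, i, false))
    (fun C => Function.update C u (x, i, false)) ?_ ?_ ?_ ?_ ?_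
  · intro C hC
    rw [mem_filter] at hC ⊢
    exact ⟨mem_univ _, hmem x y C hC.2, by simp⟩
  · intro C hC
    rw [mem_filter] at hC ⊢
    exact ⟨mem_univ _, hmem y x C hC.2, by simp⟩
  · intro C hC
    simp [← (mem_filter.1 hC).2.2]
  · intro C hC
    simp [← (mem_filter.1 hC).2.2]
  · intro C hC
    rw [configProb_eq_prod, configProb_eq_prod, ← mul_prod_erase univ _ (mem_univ u),
      ← mul_prod_erase univ (fun v => circuitWeight b (p v) (Function.update C u (y, i, false) v))
        (mem_univ u)]
    have : ∏ v ∈ univ.erase u, circuitWeight b (p v) (Function.update C u (y, i, false) v) =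
        ∏ v ∈ univ.erase u, circuitWeight b (p v) (C v) :=
      prod_congr rfl fun v hv => by rw [Function.update_of_ne (ne_of_mem_erase hv)]
    rw [this, (mem_filter.1 hC).2.2, Function.update_self]
    simp only [circuitWeight]
    ring

lemma cellProb_false_eq (hp : ∀ v, p v ∈ stdSimplex ℝ Δ) (u : U) (C₀ : Configuration U Δ)
    (i : Bool) (x : Δ) :
    cellProb b p u C₀ (x, i, false) = p u x * ∑ y, cellProb b p u C₀ (y, i, false) := by
  have h : ∑ y, cellProb b p u C₀ (x, i, false) * p u y =
      ∑ y, cellProb b p u C₀ (y, i, false) * p u x :=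
    sum_congr rfl fun y _ => cellProb_mul_comm u C₀ i x y
  rw [← mul_sum, ← sum_mul, (hp u).2, mul_one] at h
  rw [h, mul_comm]

lemma configProb_comp_swap {U Δ : Type*} [Fintype U] {b : ℝ} {p : U → Δ → ℝ}
    {C : Configuration U Δ} {u v : U} (huv : u ≠ v)
    (h : C.dest u = C.dest v) :
    configProb b p (C ∘ Equiv.swap u v) = configProb b p C := by
  have hv : v ∈ univ.erase u := mem_erase.2 ⟨huv.symm, mem_univ _⟩
  have hsplit : ∀ f : U → ℝ, ∏ w, f w = f u * (f v * ∏ w ∈ (univ.erase u).erase v, f w) := by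
    intro f
    rw [mul_prod_erase _ _ hv, mul_prod_erase _ _ (mem_univ u)]
  have hrest : ∏ w ∈ (univ.erase u).erase v, circuitWeight b (p w) ((C ∘ Equiv.swap u v) w) =
      ∏ w ∈ (univ.erase u).erase v, circuitWeight b (p w) (C w) := by
    refine prod_congr rfl fun w hw => ?_
    rw [mem_erase, mem_erase] at hw
    rw [Function.comp_apply, Equiv.swap_apply_of_ne_of_ne hw.2.1 hw.1]
  rw [configProb_eq_prod, configProb_eq_prod, hsplit, hrest,
    hsplit fun w => circuitWeight b (p w) (C w)]
  have h' : (C u).1 = (C v).1 := h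
  simp only [Function.comp_apply, Equiv.swap_apply_left, Equiv.swap_apply_right, circuitWeight, h']
  ring

lemma sum_configProb_swap (u v : U) (huv : u ≠ v) (C₀ : Configuration U Δ) (x : Δ) :
    ∑ C : Configuration U Δ with (Indistinguishable C C₀ ∧ C u = (x, false, true)) ∧
        C v = (x, false, false), configProb b p C =
      ∑ C : Configuration U Δ with (Indistinguishable C C₀ ∧ C u = (x, false, false)) ∧
        C v = (x, false, true), configProb b p C := by
  have hmem : ∀ (o o' : Bool) (C : Configuration U Δ),
      (Indistinguishable C C₀ ∧ C u = (x, false, o)) ∧ C v = (x, false, o') →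
      (Indistinguishable (C ∘ Equiv.swap u v) C₀ ∧
        (C ∘ Equiv.swap u v) u = (x, false, o')) ∧ (C ∘ Equiv.swap u v) v = (x, false, o) := by
    intro o o' C ⟨⟨h1, h2⟩, h3⟩
    refine ⟨⟨?_, by simp [h3]⟩, by simp [h2]⟩
    exact (observation_comp_swap (by simp [Configuration.input, h2])
      (by simp [Configuration.input, h3])).trans h1
  refine sum_nbij' (fun C => C ∘ Equiv.swap u v) (fun C => C ∘ Equiv.swap u v) ?_ ?_ ?_ ?_ ?_
  · intro C hC
    rw [mem_filter] at hC ⊢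
    exact ⟨mem_univ _, hmem _ _ C hC.2⟩
  · intro C hC
    rw [mem_filter] at hC ⊢
    exact ⟨mem_univ _, hmem _ _ C hC.2⟩
  · intro C _
    funext w
    simp
  · intro C _
    funext w
    simp
  · intro C hC
    rw [mem_filter] at hC
    refine (configProb_comp_swap huv ?_).symm
    simp [Configuration.dest, hC.2.1.2, hC.2.2]

/-- Double counting of the pairs of a configuration and a user with whom `u` can exchange
circuits. -/
lemma sum_mul_unlinkedCount (u : U) (C₀ : Configuration U Δ) (x : Δ) :
    ∑ C : Configuration U Δ with Indistinguishable C C₀ ∧ C u = (x, false, true),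
        configProb b p C * (unlinkedCount p u x false C : ℝ) =
      ∑ C : Configuration U Δ with Indistinguishable C C₀ ∧ C u = (x, false, false),
        configProb b p C * (unlinkedCount p u x true C : ℝ) := by
  have key : ∀ o o' : Bool,
      ∑ C : Configuration U Δ with Indistinguishable C C₀ ∧ C u = (x, false, o),
        configProb b p C * (unlinkedCount p u x o' C : ℝ) =
      ∑ v ∈ alwaysVisit p u x, ∑ C : Configuration U Δ with
        (Indistinguishable C C₀ ∧ C u = (x, false, o)) ∧ C v = (x, false, o'),
          configProb b p C := by
    intro o o'
    have hC : ∀ C : Configuration U Δ, configProb b p C * (unlinkedCount p u x o' C : ℝ) =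
        ∑ v ∈ alwaysVisit p u x, if C v = (x, false, o') then configProb b p C else 0 := by
      intro C
      rw [unlinkedCount, card_eq_sum_ones, Nat.cast_sum, sum_filter, mul_sum]
      refine sum_congr rfl fun v _ => ?_
      split_ifs <;> simp
    simp only [hC]
    rw [sum_comm]
    refine sum_congr rfl fun v _ => ?_
    rw [← sum_filter, filter_filter]
  rw [key, key]
  refine sum_congr rfl fun v hv => ?_
  exact sum_configProb_swap u v (mem_filter.1 hv).2.1.symm C₀ x

lemma eq_of_apply_eq_one {q : Δ → ℝ} (hq : q ∈ stdSimplex ℝ Δ) {x y : Δ} (hx : q x = 1)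
    (hy : q y ≠ 0) : y = x := by
  by_contra hne
  have hle : q y + q x ≤ ∑ y, q y := by
    rw [← sum_pair hne]
    exact sum_le_sum_of_subset_of_nonneg (subset_univ _) fun y _ _ => hq.1 y
  rw [hq.2, hx] at hle
  exact hy (le_antisymm (by linarith) (hq.1 y))

lemma dest_eq_of_configProb_ne_zero (hp : ∀ v, p v ∈ stdSimplex ℝ Δ) {C : Configuration U Δ}
    (hC : configProb b p C ≠ 0) {v : U} {x : Δ} (hx : p v x = 1) : C.dest v = x :=
  eq_of_apply_eq_one (hp v) hx fun h0 => hC (prod_eq_zero (mem_univ v) (by simp [h0]))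

lemma unlinkedCount_true_add (hp : ∀ v, p v ∈ stdSimplex ℝ Δ) {u : U}
    (hdet : ∀ v, v ≠ u → ∃ y, p v y = 1) {C : Configuration U Δ}
    (hC : configProb b p C ≠ 0) (x : Δ) :
    unlinkedCount p u x true C + (if C u = (x, false, true) then 1 else 0) =
      #{v | C v = (x, false, true)} := by
  have hset : ({v ∈ alwaysVisit p u x | C v = (x, false, true)} : Finset U) =
      ({v | C v = (x, false, true)} : Finset U).erase u := by
    ext v
    simp only [alwaysVisit, mem_filter, mem_univ, true_and, mem_erase]
    constructor
    · exact fun h => ⟨h.1.1, h.2⟩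
    · rintro ⟨h1, h2⟩
      obtain ⟨y, hy⟩ := hdet v h1
      have := dest_eq_of_configProb_ne_zero hp hC hy
      rw [Configuration.dest, h2] at this
      exact ⟨⟨h1, by subst this; exact hy⟩, h2⟩
  rw [unlinkedCount, hset]
  split_ifs with h
  · exact card_erase_add_one (by simpa using h)
  · rw [erase_eq_of_notMem (by simpa using h), add_zero]

lemma unlinkedCount_true_add_false (hp : ∀ v, p v ∈ stdSimplex ℝ Δ) {u : U}
    {C : Configuration U Δ} (hC : configProb b p C ≠ 0) (x : Δ) :
    unlinkedCount p u x true C + unlinkedCount p u x false C =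
      #{v ∈ alwaysVisit p u x | C.input v = false} := by
  rw [unlinkedCount, unlinkedCount, ← card_union_of_disjoint]
  · congr 1
    rw [← filter_or]
    refine Finset.filter_congr fun v hv => ?_
    have := dest_eq_of_configProb_ne_zero hp hC (mem_filter.1 hv).2.2
    obtain ⟨y, i, o, h⟩ : ∃ y i o, C v = (y, i, o) := ⟨_, _, _, rfl⟩
    simp only [Configuration.dest, Configuration.input, h] at this ⊢
    subst this
    cases o <;> simp
  · rw [disjoint_filter]
    intro v _ h1 h2
    simp [h1] at h2

/-- The switching identity. Exchanging the circuit of `u` with that of a user who always visits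
`x` compares the cells in which the output of `u` at `x` is and is not observed, with the counts
taken in a single configuration of the class. -/
lemma cellProb_mul_switch (hp : ∀ v, p v ∈ stdSimplex ℝ Δ) {u : U}
    (hdet : ∀ v, v ≠ u → ∃ y, p v y = 1) {C₀ : Configuration U Δ}
    (hC₀ : configProb b p C₀ ≠ 0) (x : Δ) :
    cellProb b p u C₀ (x, false, true) * (unlinkedCount p u x false C₀ + 1 -
        (if C₀ u = (x, false, true) then 1 else 0)) =
      cellProb b p u C₀ (x, false, false) * (unlinkedCount p u x true C₀ +
        (if C₀ u = (x, false, true) then 1 else 0)) := by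
  have hcount : ∀ C, configProb b p C ≠ 0 → Indistinguishable C C₀ →
      (unlinkedCount p u x true C + (if C u = (x, false, true) then 1 else 0) : ℝ) =
        unlinkedCount p u x true C₀ + (if C₀ u = (x, false, true) then 1 else 0) ∧
      (unlinkedCount p u x true C + unlinkedCount p u x false C : ℝ) =
        unlinkedCount p u x true C₀ + unlinkedCount p u x false C₀ := by
    intro C hC hind
    constructor
    · exact_mod_cast (unlinkedCount_true_add hp hdet hC x).trans
        ((Indistinguishable.card_exit_eq (Eq.symm hind) x).trans
          (unlinkedCount_true_add hp hdet hC₀ x).symm)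
    · have hin : #{v ∈ alwaysVisit p u x | C.input v = false} =
          #{v ∈ alwaysVisit p u x | C₀.input v = false} := by
        simp only [hind.input_eq]
      exact_mod_cast (unlinkedCount_true_add_false hp hC x).trans
        (hin.trans (unlinkedCount_true_add_false hp hC₀ x).symm)
  have h := sum_mul_unlinkedCount (b := b) (p := p) u C₀ x
  rw [cellProb, cellProb, sum_mul, sum_mul]
  refine Eq.trans ?_ (h.trans ?_)
  · refine sum_congr rfl fun C hC => ?_
    by_cases h0 : configProb b p C = 0
    · simp [h0]
    obtain ⟨h1, h2⟩ := hcount C h0 (mem_filter.1 hC).2.1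
    rw [if_pos (mem_filter.1 hC).2.2] at h1
    congr 1
    linarith
  · refine sum_congr rfl fun C hC => ?_
    by_cases h0 : configProb b p C = 0
    · simp [h0]
    obtain ⟨h1, -⟩ := hcount C h0 (mem_filter.1 hC).2.1
    rw [if_neg (by simp [(mem_filter.1 hC).2.2])] at h1
    congr 1
    linarith

end

/-! ### The posterior probability of a single observation -/

noncomputable section

open Classical

variable {U Δ : Type*} [Fintype U] [Fintype Δ] {b : ℝ} {p : U → Δ → ℝ}

/-- The expected value of `unlinkedCount p u x o`. -/
def unlinkedMean (b : ℝ) (p : U → Δ → ℝ) (u : U) (x : Δ) (o : Bool) : ℝ :=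
  #(alwaysVisit p u x) * ((1 - b) * bernoulliWeight b o)

/-- The total deviation, increased by `1`, of the two counts for `x` from their means. -/
def deviation (b : ℝ) (p : U → Δ → ℝ) (u : U) (x : Δ) (C : Configuration U Δ) : ℝ :=
  1 + |unlinkedCount p u x false C - unlinkedMean b p u x false| +
    |unlinkedCount p u x true C - unlinkedMean b p u x true|

lemma one_le_deviation {U Δ : Type*} [Fintype U] {b : ℝ} {p : U → Δ → ℝ} (u : U)
    (x : Δ) (C : Configuration U Δ) : 1 ≤ deviation b p u x C := by
  have := abs_nonneg ((unlinkedCount p u x false C : ℝ) - unlinkedMean b p u x false)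
  have := abs_nonneg ((unlinkedCount p u x true C : ℝ) - unlinkedMean b p u x true)
  unfold deviation
  linarith

/-- If the input of `u` is observed and its output is not, then `Ψ` is the prior. -/
lemma posterior_eq_prior (hb0 : 0 ≤ b) (hb1 : b ≤ 1) (hp : ∀ v, p v ∈ stdSimplex ℝ Δ)
    {u : U} {d : Δ} {C₀ : Configuration U Δ} (hC₀ : configProb b p C₀ ≠ 0)
    (hu : C₀ u = (d, true, false)) : posterior b p u d C₀ = p u d := by
  have hcell : ∀ x i o, (i, o) ≠ (true, false) → cellProb b p u C₀ (x, i, o) = 0 := by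
    intro x i o hne
    refine cellProb_eq_zero fun C _ hind hCu => hne ?_
    have hi : C₀.input u = true := by simp [Configuration.input, hu]
    have h1 := Indistinguishable.input_eq (Eq.symm hind) u
    have h2 := Indistinguishable.output_eq (Eq.symm hind) hi
    simp only [Configuration.input, Configuration.output, hu, hCu] at h1 h2
    rw [h1, h2]
  have hsum : ∀ x, ∑ y, cellProb b p u C₀ (x, y) = cellProb b p u C₀ (x, true, false) := by
    intro x
    refine sum_eq_single _ (fun y _ hy => hcell x y.1 y.2 hy) (by simp)
  have hpos : 0 < cellProb b p u C₀ (d, true, false) := by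
    rw [← hu]
    exact (lt_of_le_of_ne (configProb_nonneg hb0 hb1 hp C₀) hC₀.symm).trans_le
      (configProb_le_cellProb hb0 hb1 hp u C₀)
  rw [posterior_eq_div]
  simp only [hsum]
  rw [cellProb_false_eq hp] at hpos ⊢
  exact mul_div_cancel_right₀ _ (fun h => by simp [h] at hpos)

/-- If `u` is linked to its destination, then `Ψ = 1`. -/
lemma posterior_eq_one_of_linked (hb0 : 0 ≤ b) (hb1 : b ≤ 1) (hp : ∀ v, p v ∈ stdSimplex ℝ Δ)
    {u : U} {d : Δ} {C₀ : Configuration U Δ} (hC₀ : configProb b p C₀ ≠ 0)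
    (hu : C₀ u = (d, true, true)) : posterior b p u d C₀ = 1 := by
  have hcell : ∀ x, x ≠ d → ∑ y, cellProb b p u C₀ (x, y) = 0 := by
    intro x hne
    refine sum_eq_zero fun y _ => cellProb_eq_zero fun C _ hind hCu => hne ?_
    have h1 := Indistinguishable.dest_eq (Eq.symm hind) (v := u)
      (by simp [Configuration.input, hu]) (by simp [Configuration.output, hu])
    simpa only [Configuration.dest, hu, hCu] using h1
  have hpos : 0 < ∑ y, cellProb b p u C₀ (d, y) := by
    refine lt_of_lt_of_le (lt_of_le_of_ne (configProb_nonneg hb0 hb1 hp C₀) hC₀.symm)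
      ((configProb_le_cellProb hb0 hb1 hp u C₀).trans ?_)
    rw [hu]
    exact single_le_sum (f := fun y => cellProb b p u C₀ (d, y))
      (fun y _ => cellProb_nonneg hb0 hb1 hp u C₀ _) (mem_univ _)
  rw [posterior_eq_div, sum_eq_single d (fun x _ hx => hcell x hx) (by simp)]
  exact div_self hpos.ne'

/-- The probability of the part of the observation class of `C₀` in which neither the input nor
the output of `u` is observed. -/
def hiddenProb (b : ℝ) (p : U → Δ → ℝ) (u : U) (C₀ : Configuration U Δ) : ℝ :=
  ∑ x, cellProb b p u C₀ (x, false, false)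

lemma hiddenProb_nonneg (hb0 : 0 ≤ b) (hb1 : b ≤ 1) (hp : ∀ v, p v ∈ stdSimplex ℝ Δ)
    (u : U) (C₀ : Configuration U Δ) : 0 ≤ hiddenProb b p u C₀ :=
  sum_nonneg fun _ _ => cellProb_nonneg hb0 hb1 hp u C₀ _

lemma posterior_eq_of_input_false (hp : ∀ v, p v ∈ stdSimplex ℝ Δ) {u : U} {d : Δ}
    {C₀ : Configuration U Δ} (hu : C₀.input u = false) :
    posterior b p u d C₀ =
      (cellProb b p u C₀ (d, false, true) + p u d * hiddenProb b p u C₀) /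
        (∑ x, cellProb b p u C₀ (x, false, true) + hiddenProb b p u C₀) := by
  have hsum : ∀ x, ∑ y, cellProb b p u C₀ (x, y) =
      cellProb b p u C₀ (x, false, true) + cellProb b p u C₀ (x, false, false) := by
    intro x
    have hcell : ∀ o, cellProb b p u C₀ (x, true, o) = 0 := by
      refine fun o => cellProb_eq_zero fun C _ hind hCu => ?_
      have h1 := Indistinguishable.input_eq (Eq.symm hind) u
      rw [hu] at h1
      simp [Configuration.input, hCu] at h1
    simp [Fintype.sum_prod_type, hcell]
  rw [posterior_eq_div]
  simp only [hsum, sum_add_distrib]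
  rw [cellProb_false_eq hp u C₀ false d]
  rfl

/-- The observation class has positive probability. -/
lemma classProb_pos (hb0 : 0 ≤ b) (hb1 : b ≤ 1) (hp : ∀ v, p v ∈ stdSimplex ℝ Δ)
    {u : U} {C₀ : Configuration U Δ} (hC₀ : configProb b p C₀ ≠ 0) (hu : C₀.input u = false) :
    0 < ∑ x, cellProb b p u C₀ (x, false, true) + hiddenProb b p u C₀ := by
  rw [hiddenProb, ← sum_add_distrib]
  refine lt_of_lt_of_le (lt_of_le_of_ne (configProb_nonneg hb0 hb1 hp C₀) hC₀.symm)
    ((configProb_le_cellProb hb0 hb1 hp u C₀).trans ?_)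
  have h0 := fun s => cellProb_nonneg hb0 hb1 hp u C₀ s
  obtain ⟨x, i, o, hx⟩ : ∃ x i o, C₀ u = (x, i, o) := ⟨_, _, _, rfl⟩
  have hi : i = false := by simpa [Configuration.input, hx] using hu
  subst hi
  refine le_trans ?_ (single_le_sum (f := fun x => cellProb b p u C₀ (x, false, true) +
      cellProb b p u C₀ (x, false, false)) (fun y _ => add_nonneg (h0 _) (h0 _)) (mem_univ x))
  rw [hx]
  cases o
  · exact le_add_of_nonneg_left (h0 _)
  · exact le_add_of_nonneg_right (h0 _)

/-- If no other user visits `x` and `u` is not seen there, the class contains no configuration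
in which `u` is seen at `x`. -/
lemma cellProb_eq_zero_of_alwaysVisit_eq_empty (hp : ∀ v, p v ∈ stdSimplex ℝ Δ) {u : U}
    (hdet : ∀ v, v ≠ u → ∃ y, p v y = 1) {C₀ : Configuration U Δ} (hC₀ : configProb b p C₀ ≠ 0)
    {x : Δ} (hx : alwaysVisit p u x = ∅) (hu : C₀ u ≠ (x, false, true)) :
    cellProb b p u C₀ (x, false, true) = 0 := by
  have h := cellProb_mul_switch hp hdet hC₀ x
  simpa [unlinkedCount, hx, hu] using h

/-- In a typical configuration, the part of the observation class in which `u` is seen at `x` and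
the part in which neither indicator of `u` is set have probabilities in the ratio
`p u x * b : 1 - b`. -/
lemma unlinkedMean_mul_abs_le (hb0 : 0 ≤ b) (hb1 : b ≤ 1) (hp : ∀ v, p v ∈ stdSimplex ℝ Δ) {u : U}
    (hdet : ∀ v, v ≠ u → ∃ y, p v y = 1) {C₀ : Configuration U Δ}
    (hC₀ : configProb b p C₀ ≠ 0) (x : Δ) :
    unlinkedMean b p u x false *
        |(1 - b) * cellProb b p u C₀ (x, false, true) - p u x * b * hiddenProb b p u C₀| ≤
      2 * deviation b p u x C₀ *
        (∑ x, cellProb b p u C₀ (x, false, true) + hiddenProb b p u C₀) := by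
  have hcell := cellProb_false_eq (b := b) hp u C₀ false x
  have hsw := cellProb_mul_switch hp hdet hC₀ x
  rw [hcell] at hsw
  change _ = p u x * hiddenProb b p u C₀ * _ at hsw
  have ha0 := cellProb_nonneg hb0 hb1 hp u C₀ (x, false, true)
  have hz0 := hiddenProb_nonneg hb0 hb1 hp u C₀
  have haT : cellProb b p u C₀ (x, false, true) ≤ ∑ x, cellProb b p u C₀ (x, false, true) :=
    single_le_sum (f := fun x => cellProb b p u C₀ (x, false, true))
      (fun _ _ => cellProb_nonneg hb0 hb1 hp u C₀ _) (mem_univ x)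
  set a := cellProb b p u C₀ (x, false, true)
  set z := hiddenProb b p u C₀
  set S := ∑ x, cellProb b p u C₀ (x, false, true)
  have hq0 : 0 ≤ p u x := (hp u).1 x
  have hq1 : p u x ≤ 1 := by
    rw [← (hp u).2]
    exact single_le_sum (fun y _ => (hp u).1 y) (mem_univ x)
  set q := p u x
  set e : ℝ := if C₀ u = (x, false, true) then 1 else 0 with he
  have he0 : 0 ≤ e := by rw [he]; split_ifs <;> norm_num
  have he1 : e ≤ 1 := by rw [he]; split_ifs <;> norm_num
  have hm : (1 - b) * unlinkedMean b p u x true = b * unlinkedMean b p u x false := by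
    simp only [unlinkedMean, bernoulliWeight]
    simp
    ring
  have hm0 : 0 ≤ unlinkedMean b p u x false := by
    simp only [unlinkedMean, bernoulliWeight]
    have : 0 ≤ 1 - b := by linarith
    simp
    positivity
  have hdev : deviation b p u x C₀ = 1 + |(unlinkedCount p u x false C₀ : ℝ) -
    unlinkedMean b p u x false| + |(unlinkedCount p u x true C₀ : ℝ) -
    unlinkedMean b p u x true| := rfl
  set N : ℝ := (unlinkedCount p u x false C₀ : ℝ)
  set Z : ℝ := (unlinkedCount p u x true C₀ : ℝ)
  set μ := unlinkedMean b p u x false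
  set ν := unlinkedMean b p u x true
  rw [hdev]
  have hqz : q * z ≤ z := mul_le_of_le_one_left hz0 hq1
  have hqz0 : 0 ≤ q * z := mul_nonneg hq0 hz0
  have hT : 0 ≤ S + z := by linarith
  have habs : |(1 - b) * a - q * b * z| ≤ S + z := by
    have h1 : (1 - b) * a ≤ a := mul_le_of_le_one_left ha0 (by linarith)
    have h2 : 0 ≤ (1 - b) * a := mul_nonneg (by linarith) ha0
    have h3 : b * (q * z) ≤ q * z := mul_le_of_le_one_left hqz0 hb1
    have h4 : 0 ≤ b * (q * z) := mul_nonneg hb0 hqz0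
    rw [abs_le]
    constructor <;> nlinarith
  have hN := abs_nonneg (N - μ)
  have hZ := abs_nonneg (Z - ν)
  by_cases hcase : μ ≤ 2 * N
  · -- many users are available for switching: divide the switching identity by their number
    have hkey : (N + 1 - e) * ((1 - b) * a - q * b * z) =
        q * z * ((1 - b) * (Z - ν) - b * (N - μ) + ((1 - b) * e - b * (1 - e))) := by
      linear_combination (1 - b) * hsw + q * z * hm
    have hrhs : |(1 - b) * (Z - ν) - b * (N - μ) + ((1 - b) * e - b * (1 - e))| ≤
        1 + |N - μ| + |Z - ν| := by
      have h1 : |(1 - b) * (Z - ν)| ≤ |Z - ν| := by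
        rw [abs_mul, abs_of_nonneg (by linarith : 0 ≤ 1 - b)]
        exact mul_le_of_le_one_left hZ (by linarith)
      have h2 : |b * (N - μ)| ≤ |N - μ| := by
        rw [abs_mul, abs_of_nonneg hb0]
        exact mul_le_of_le_one_left hN hb1
      have h3 : |(1 - b) * e - b * (1 - e)| ≤ 1 := by
        rw [abs_le]
        constructor <;> nlinarith
      calc _ ≤ |(1 - b) * (Z - ν) - b * (N - μ)| + |(1 - b) * e - b * (1 - e)| := abs_add_le _ _
        _ ≤ |(1 - b) * (Z - ν)| + |b * (N - μ)| + |(1 - b) * e - b * (1 - e)| := by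
          gcongr
          exact abs_sub _ _
        _ ≤ _ := by linarith
    have hNe : 0 ≤ N + 1 - e := by
      have : (0 : ℝ) ≤ N := Nat.cast_nonneg _
      linarith
    have h5 : (N + 1 - e) * |(1 - b) * a - q * b * z| ≤
        (1 + |N - μ| + |Z - ν|) * (S + z) := by
      rw [← abs_of_nonneg hNe, ← abs_mul, hkey, abs_mul, abs_of_nonneg hqz0, mul_comm]
      exact mul_le_mul hrhs (by linarith) hqz0 (by linarith)
    have h6 : μ * |(1 - b) * a - q * b * z| ≤
        2 * (N + 1 - e) * |(1 - b) * a - q * b * z| :=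
      mul_le_mul_of_nonneg_right (by linarith) (abs_nonneg _)
    linarith
  · -- otherwise the count is far below its mean
    have h1 : μ ≤ 2 * (1 + |N - μ| + |Z - ν|) := by
      have := neg_abs_le (N - μ)
      linarith
    exact mul_le_mul h1 habs (abs_nonneg _) (by linarith)

end

/-! ### Averaging over the observations -/

noncomputable section

open Classical

variable {U Δ : Type*} [Fintype U] [Fintype Δ] {b : ℝ} {p : U → Δ → ℝ}

lemma sum_configProb_mul_abs_unlinkedCount_le (hb0 : 0 ≤ b) (hb1 : b ≤ 1)
    (hp : ∀ v, p v ∈ stdSimplex ℝ Δ) {n : ℝ} (hn : 0 < n) (u : U) (x : Δ) (o : Bool)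
    (hV : (#(alwaysVisit p u x) : ℝ) ≤ n) :
    ∑ C : Configuration U Δ,
      configProb b p C * |unlinkedCount p u x o C - unlinkedMean b p u x o| ≤ √n := by
  set m : ℝ := (1 - b) * bernoulliWeight b o with hm
  have hm0 : 0 ≤ m := mul_nonneg (by linarith) (bernoulliWeight_nonneg hb0 hb1 o)
  have hm1 : m ≤ 1 := mul_le_one₀ (by linarith) (bernoulliWeight_nonneg hb0 hb1 o)
    (bernoulliWeight_le_one hb0 hb1 o)
  have hcount : ∀ C : Configuration U Δ,
      (unlinkedCount p u x o C : ℝ) - unlinkedMean b p u x o =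
        ∑ v ∈ alwaysVisit p u x, ((if C v = (x, false, o) then 1 else 0) - m) := by
    intro C
    rw [sum_sub_distrib, unlinkedCount, unlinkedMean, card_filter]
    simp [hm]
  simp only [hcount]
  refine sum_configProb_mul_abs_le hb0 hb1 hp _
    (fun s => (if s = (x, false, o) then 1 else 0) - m) ?_ ?_ hn hV
  · intro s
    rw [abs_le]
    split_ifs <;> constructor <;> linarith
  · intro v hv
    simp only [mul_sub, sum_sub_distrib, ← sum_mul, sum_circuitWeight (hp v)]
    have : p v x = 1 := (mem_filter.1 hv).2.2
    simp [circuitWeight, this, hm, bernoulliWeight]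

lemma sum_configProb_mul_deviation_le (hb0 : 0 ≤ b) (hb1 : b ≤ 1)
    (hp : ∀ v, p v ∈ stdSimplex ℝ Δ) {n : ℝ} (hn : 0 < n) (u : U) (x : Δ)
    (hV : (#(alwaysVisit p u x) : ℝ) ≤ n) :
    ∑ C : Configuration U Δ, configProb b p C * deviation b p u x C ≤ 1 + 2 * √n := by
  have h0 := sum_configProb_mul_abs_unlinkedCount_le hb0 hb1 hp hn u x false hV
  have h1 := sum_configProb_mul_abs_unlinkedCount_le hb0 hb1 hp hn u x true hV
  simp only [deviation, mul_add, sum_add_distrib, mul_one, sum_configProb hp]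
  linarith

lemma sum_destEvent_mul (hp : ∀ v, p v ∈ stdSimplex ℝ Δ) (u : U) (d : Δ)
    (f : Bool → Bool → ℝ) :
    ∑ C : Configuration U Δ with C ∈ destEvent u d,
        configProb b p C * f (C.input u) (C.output u) =
      p u d * ∑ i, ∑ o, bernoulliWeight b i * bernoulliWeight b o * f i o := by
  have h := sum_configProb_mul_apply (b := b) hp u
    (fun s => if s.1 = d then f s.2.1 s.2.2 else 0)
  rw [sum_filter]
  refine Eq.trans (sum_congr rfl fun C _ => ?_) (h.trans ?_)
  · have hmem : C ∈ destEvent u d ↔ (C u).1 = d := Iff.rfl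
    by_cases hC : (C u).1 = d
    · rw [if_pos (hmem.2 hC), if_pos hC]
      rfl
    · rw [if_neg (mt hmem.1 hC), if_neg hC, mul_zero]
  · rw [Fintype.sum_prod_type, sum_eq_single d (fun x _ hx => by simp [hx]) (by simp)]
    simp only [Fintype.sum_prod_type, circuitWeight, if_true, mul_sum]
    exact sum_congr rfl fun i _ => sum_congr rfl fun o _ => by ring

lemma prob_destEvent (hp : ∀ v, p v ∈ stdSimplex ℝ Δ) (u : U) (d : Δ) :
    prob b p (destEvent u d) = p u d := by
  have h := sum_destEvent_mul (b := b) hp u d (fun _ _ => 1)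
  simp only [mul_one] at h
  rw [prob, h]
  simp [bernoulliWeight]
  ring

/-- If `Ψ` is close to a value depending only on the indicators of `u`, then its expectation is
close to the average of these values. -/
lemma abs_expectedPosterior_sub_le (hb0 : 0 ≤ b) (hb1 : b ≤ 1)
    (hp : ∀ v, p v ∈ stdSimplex ℝ Δ) {u : U} {d : Δ} (hd : 0 < p u d) (f : Bool → Bool → ℝ)
    (err : Configuration U Δ → ℝ) (herr : ∀ C, 0 ≤ err C)
    (h : ∀ C i o, configProb b p C ≠ 0 → C u = (d, i, o) →
      |posterior b p u d C - f i o| ≤ err C) :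
    |expectedPosterior b p u d -
        ∑ i, ∑ o, bernoulliWeight b i * bernoulliWeight b o * f i o| ≤
      (∑ C : Configuration U Δ, configProb b p C * err C) / p u d := by
  have h1 : expectedPosterior b p u d -
        ∑ i, ∑ o, bernoulliWeight b i * bernoulliWeight b o * f i o =
      (∑ C : Configuration U Δ with C ∈ destEvent u d,
        configProb b p C * (posterior b p u d C - f (C.input u) (C.output u))) / p u d := by
    simp only [mul_sub, sum_sub_distrib]
    rw [sum_destEvent_mul hp, sub_div, mul_div_cancel_left₀ _ hd.ne', expectedPosterior,
      condExpect, prob_destEvent hp]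
  rw [h1, abs_div, abs_of_pos hd]
  refine div_le_div_of_nonneg_right ?_ hd.le
  refine (abs_sum_le_sum_abs _ _).trans ?_
  refine (sum_le_sum (g := fun C => configProb b p C * err C) fun C hC => ?_).trans
    (sum_le_sum_of_subset_of_nonneg (subset_univ _) fun C _ _ =>
      mul_nonneg (configProb_nonneg hb0 hb1 hp C) (herr C))
  rw [abs_mul, abs_of_nonneg (configProb_nonneg hb0 hb1 hp C)]
  by_cases h0 : configProb b p C = 0
  · simp [h0]
  have hdest : (C u).1 = d := (mem_filter.1 hC).2
  exact mul_le_mul_of_nonneg_left (h C _ _ h0 (by rw [← hdest]; rfl))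
    (configProb_nonneg hb0 hb1 hp C)

lemma inv_sqrt_le_two_mul_sqrt_log_div {n : ℕ} (hn : 2 ≤ n) :
    1 / √(n : ℝ) ≤ 2 * √(Real.log n / n) := by
  have hn' : (2 : ℝ) ≤ n := by exact_mod_cast hn
  have hlog : (1 / 4 : ℝ) ≤ Real.log n := by
    have := Real.log_le_log (by norm_num) hn'
    linarith [Real.log_two_gt_d9]
  have h4 : 2 * √(Real.log n / n) = √(4 * (Real.log n / n)) := by
    rw [Real.sqrt_mul (by norm_num), show (4 : ℝ) = 2 ^ 2 by norm_num,
      Real.sqrt_sq (by norm_num)]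
  rw [h4, ← Real.sqrt_one, ← Real.sqrt_div zero_le_one]
  refine Real.sqrt_le_sqrt ?_
  rw [← mul_div_assoc]
  exact div_le_div_of_nonneg_right (by linarith) (by linarith)

/-- A bound of `Ψ` by the deviations for two destinations on the event that the input of `u` is
not observed controls the expectation of `Ψ`: the other two events contribute
`b * (1 - b) * p u d + b ^ 2` exactly. -/
lemma abs_expectedPosterior_sub_le_sqrt (hb0 : 0 ≤ b) (hb1 : b ≤ 1)
    (hp : ∀ v, p v ∈ stdSimplex ℝ Δ) {u : U} {d : Δ} (hd : 0 < p u d) (l : Δ) {n : ℕ}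
    (hn : Fintype.card U = n) (hn2 : 2 ≤ n) (f : Bool → ℝ) {c : ℝ} (hc : 0 ≤ c)
    (h : ∀ C o, configProb b p C ≠ 0 → C u = (d, false, o) →
      |posterior b p u d C - f o| ≤ c / n * (deviation b p u d C + deviation b p u l C)) :
    |expectedPosterior b p u d - (b * (1 - b) * p u d + b ^ 2 +
        (1 - b) * (b * f true + (1 - b) * f false))| ≤
      12 * c / p u d * √(Real.log n / n) := by
  have hn0 : (2 : ℝ) ≤ n := by exact_mod_cast hn2
  have hnpos : (0 : ℝ) < n := by linarith
  have herr : ∀ C : Configuration U Δ,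
      0 ≤ c / n * (deviation b p u d C + deviation b p u l C) := by
    intro C
    have := one_le_deviation (b := b) (p := p) u d C
    have := one_le_deviation (b := b) (p := p) u l C
    exact mul_nonneg (by positivity) (by linarith)
  have hmain := abs_expectedPosterior_sub_le hb0 hb1 hp hd
    (fun i o => bif i then (bif o then 1 else p u d) else f o) _ herr (by
      intro C i o hC hu
      cases i
      · exact h C o hC hu
      · cases o
        · simpa [posterior_eq_prior hb0 hb1 hp hC hu] using herr C
        · simpa [posterior_eq_one_of_linked hb0 hb1 hp hC hu] using herr C)
  have hsum : ∑ i, ∑ o, bernoulliWeight b i * bernoulliWeight b o *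
      (bif i then (bif o then 1 else p u d) else f o) = b * (1 - b) * p u d + b ^ 2 +
        (1 - b) * (b * f true + (1 - b) * f false) := by
    simp [bernoulliWeight]
    ring
  rw [hsum] at hmain
  refine hmain.trans ?_
  have hcard : ∀ x, (#(alwaysVisit p u x) : ℝ) ≤ n := by
    intro x
    rw [← hn]
    exact_mod_cast card_le_univ _
  have h1 : ∑ C : Configuration U Δ,
      configProb b p C * (c / n * (deviation b p u d C + deviation b p u l C)) ≤
      c / n * (2 + 4 * √(n : ℝ)) := by
    have hd' := sum_configProb_mul_deviation_le hb0 hb1 hp hnpos u d (hcard d)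
    have hl' := sum_configProb_mul_deviation_le hb0 hb1 hp hnpos u l (hcard l)
    calc _ = c / n * (∑ C : Configuration U Δ, configProb b p C * deviation b p u d C +
        ∑ C : Configuration U Δ, configProb b p C * deviation b p u l C) := by
          rw [← sum_add_distrib, mul_sum]
          exact sum_congr rfl fun C _ => by ring
      _ ≤ _ := mul_le_mul_of_nonneg_left (by linarith) (by positivity)
  have hs1 : 1 ≤ √(n : ℝ) := Real.one_le_sqrt.2 (by linarith)
  have h2 : c / n * (2 + 4 * √(n : ℝ)) ≤ 6 * c * (1 / √(n : ℝ)) := by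
    have hss : √(n : ℝ) * √(n : ℝ) = n := Real.mul_self_sqrt hnpos.le
    calc c / n * (2 + 4 * √(n : ℝ)) ≤ c / n * (6 * √(n : ℝ)) :=
          mul_le_mul_of_nonneg_left (by linarith) (by positivity)
      _ = 6 * c * (1 / √(n : ℝ)) := by
          nth_rw 1 [← hss]
          field_simp
  have h3 : 6 * c * (1 / √(n : ℝ)) ≤ 6 * c * (2 * √(Real.log n / n)) :=
    mul_le_mul_of_nonneg_left (inv_sqrt_le_two_mul_sqrt_log_div hn2) (by positivity)
  calc _ ≤ (6 * c * (2 * √(Real.log n / n))) / p u d :=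
        div_le_div_of_nonneg_right (h1.trans (h2.trans h3)) hd.le
    _ = _ := by ring

/-! ### The three populations -/

lemma card_alwaysVisit_add_le (hp : ∀ v, p v ∈ stdSimplex ℝ Δ) (u : U) {x y : Δ} (hxy : x ≠ y) :
    #(alwaysVisit p u x) + #(alwaysVisit p u y) ≤ Fintype.card U - 1 := by
  rw [← card_union_of_disjoint, ← card_univ, ← card_erase_of_mem (mem_univ u)]
  · refine card_le_card fun v hv => ?_
    rw [mem_union] at hv
    refine mem_erase.2 ⟨?_, mem_univ v⟩
    exact hv.elim (fun h => (mem_filter.1 h).2.1) fun h => (mem_filter.1 h).2.1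
  · rw [disjoint_left]
    intro v hv hv'
    refine hxy (eq_of_apply_eq_one (hp v) (mem_filter.1 hv').2.2 ?_)
    simp [(mem_filter.1 hv).2.2]

lemma card_sub_one_le_card_alwaysVisit_add {U Δ : Type*} [Fintype U] {p : U → Δ → ℝ} {u : U}
    {x y : Δ}
    (h : ∀ v, v ≠ u → p v x = 1 ∨ p v y = 1) :
    Fintype.card U - 1 ≤ #(alwaysVisit p u x) + #(alwaysVisit p u y) := by
  rw [← card_univ, ← card_erase_of_mem (mem_univ u)]
  refine (card_le_card fun v hv => ?_).trans (card_union_le _ _)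
  have hvu := (mem_erase.1 hv).1
  simpa [alwaysVisit, hvu] using h v hvu

lemma fractionAlways_eq {U Δ : Type*} [Fintype U] {p : U → Δ → ℝ} (u : U) (d : Δ) :
    fractionAlways p u d = #(alwaysVisit p u d) / ((Fintype.card U : ℝ) - 1) := rfl

lemma alwaysVisit_eq_empty (hp : ∀ v, p v ∈ stdSimplex ℝ Δ) {u : U} {d l x : Δ}
    (h : ∀ v, v ≠ u → p v d = 1 ∨ p v l = 1) (hxd : x ≠ d) (hxl : x ≠ l) :
    alwaysVisit p u x = ∅ := by
  refine filter_eq_empty_iff.2 fun v _ hv => ?_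
  have hx : p v x ≠ 0 := by simp [hv.2]
  rcases h v hv.1 with h | h
  · exact hxd (eq_of_apply_eq_one (hp v) h hx)
  · exact hxl (eq_of_apply_eq_one (hp v) h hx)

/-- Only the cells of the two destinations of the other users contribute. -/
lemma sum_cellProb_eq_add (hp : ∀ v, p v ∈ stdSimplex ℝ Δ) {u : U} {d l : Δ} (hdl : d ≠ l)
    (h : ∀ v, v ≠ u → p v d = 1 ∨ p v l = 1) {C₀ : Configuration U Δ}
    (hC₀ : configProb b p C₀ ≠ 0) {o : Bool} (hu : C₀ u = (d, false, o)) :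
    ∑ x, cellProb b p u C₀ (x, false, true) =
      cellProb b p u C₀ (d, false, true) + cellProb b p u C₀ (l, false, true) := by
  refine Fintype.sum_eq_add d l hdl fun x hx => ?_
  refine cellProb_eq_zero_of_alwaysVisit_eq_empty hp
    (fun v hv => (h v hv).elim (fun h => ⟨_, h⟩) fun h => ⟨_, h⟩) hC₀
    (alwaysVisit_eq_empty hp h hx.1 hx.2) ?_
  rw [hu]
  simp [hx.1.symm]

lemma lt_one_of_input_false {U Δ : Type*} [Fintype U] {b : ℝ} {p : U → Δ → ℝ} (hb1 : b ≤ 1)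
    {C₀ : Configuration U Δ} (hC₀ : configProb b p C₀ ≠ 0)
    {u : U} (hu : C₀.input u = false) : b < 1 := by
  refine lt_of_le_of_ne hb1 fun hb => hC₀ (prod_eq_zero (mem_univ u) ?_)
  simp [hu, hb, bernoulliWeight]

/-- If at least `γ * (n - 1)` users always visit `x`, then the ratio of the two cells of `x` in the
observation class is off by `O(deviation / n)`. -/
lemma abs_cellProb_sub_le (hb0 : 0 ≤ b) (hb1 : b < 1) (hp : ∀ v, p v ∈ stdSimplex ℝ Δ) {u : U}
    (hdet : ∀ v, v ≠ u → ∃ y, p v y = 1) {C₀ : Configuration U Δ}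
    (hC₀ : configProb b p C₀ ≠ 0) {x : Δ} {γ : ℝ} (hγ : 0 < γ) {n : ℕ} (hn : 2 ≤ n)
    (hcard : γ * (n - 1) ≤ #(alwaysVisit p u x)) :
    |(1 - b) * cellProb b p u C₀ (x, false, true) - p u x * b * hiddenProb b p u C₀| ≤
      4 / ((1 - b) ^ 2 * γ) / n * deviation b p u x C₀ *
        (∑ x, cellProb b p u C₀ (x, false, true) + hiddenProb b p u C₀) := by
  have h := unlinkedMean_mul_abs_le hb0 hb1.le hp hdet hC₀ x
  have hn' : (2 : ℝ) ≤ n := by exact_mod_cast hn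
  have hb : 0 < 1 - b := by linarith
  have hmean : (1 - b) ^ 2 * γ * (n / 2) ≤ unlinkedMean b p u x false := by
    have h1 : γ * (n / 2) ≤ #(alwaysVisit p u x) :=
      le_trans (mul_le_mul_of_nonneg_left (by linarith) hγ.le) hcard
    have h2 := mul_le_mul_of_nonneg_right h1 (sq_nonneg (1 - b))
    simp only [unlinkedMean, bernoulliWeight]
    simp only [Bool.false_eq_true, if_false]
    linarith
  have h2 := (mul_le_mul_of_nonneg_right hmean (abs_nonneg _)).trans h
  have hpos : 0 < (1 - b) ^ 2 * γ * (n / 2) := by positivity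
  rw [mul_comm, ← le_div_iff₀ hpos] at h2
  refine h2.trans (le_of_eq ?_)
  field_simp
  ring

/-- The case in which a positive fraction of the users visits each of the two destinations. -/
lemma abs_posterior_sub_le_of_mixed (hb0 : 0 ≤ b) (hb1 : b ≤ 1)
    (hp : ∀ v, p v ∈ stdSimplex ℝ Δ) {u : U} {d l : Δ} (hdl : d ≠ l)
    (h : ∀ v, v ≠ u → p v d = 1 ∨ p v l = 1) {γ : ℝ} (hγ : 0 < γ) {n : ℕ} (hn : 2 ≤ n)
    (hd : γ * (n - 1) ≤ #(alwaysVisit p u d)) (hl : γ * (n - 1) ≤ #(alwaysVisit p u l))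
    {C₀ : Configuration U Δ} (hC₀ : configProb b p C₀ ≠ 0) {o : Bool}
    (hu : C₀ u = (d, false, o)) :
    |posterior b p u d C₀ - p u d / (1 - b + p u d * b + p u l * b)| ≤
      4 / ((1 - b) ^ 4 * γ) / n * (deviation b p u d C₀ + deviation b p u l C₀) := by
  have hdet : ∀ v, v ≠ u → ∃ y, p v y = 1 :=
    fun v hv => (h v hv).elim (fun h => ⟨_, h⟩) fun h => ⟨_, h⟩
  have hin : C₀.input u = false := by simp [Configuration.input, hu]
  have hb : 0 < 1 - b := by linarith [lt_one_of_input_false hb1 hC₀ hin]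
  have h1 := abs_cellProb_sub_le hb0 (by linarith) hp hdet hC₀ hγ hn hd
  have h2 := abs_cellProb_sub_le hb0 (by linarith) hp hdet hC₀ hγ hn hl
  have hT := classProb_pos hb0 hb1 hp hC₀ hin
  rw [posterior_eq_of_input_false hp hin]
  rw [sum_cellProb_eq_add hp hdl h hC₀ hu] at h1 h2 hT ⊢
  have hq0 : 0 ≤ p u d := (hp u).1 d
  have hr0 : 0 ≤ p u l := (hp u).1 l
  have hqr : p u d + p u l ≤ 1 := by
    rw [← (hp u).2, ← sum_pair hdl]
    exact sum_le_sum_of_subset_of_nonneg (subset_univ _) fun y _ _ => (hp u).1 y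
  have hn0 : (0 : ℝ) < n := by exact_mod_cast (by omega : 0 < n)
  set a := cellProb b p u C₀ (d, false, true)
  set y := cellProb b p u C₀ (l, false, true)
  set z := hiddenProb b p u C₀
  set q := p u d
  set r := p u l
  set T := a + y + z
  set D := 1 - b + q * b + r * b with hDdef
  have hqb : 0 ≤ q * b := mul_nonneg hq0 hb0
  have hrb : 0 ≤ r * b := mul_nonneg hr0 hb0
  have hD : 1 - b ≤ D := by linarith
  have hDpos : 0 < D := by linarith
  -- the error is a combination of the defects of the two cell ratios
  have hid : (a + q * z) / T - q / D =
      (((1 - q) * (1 - b) + r * b) * ((1 - b) * a - q * b * z) -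
        q * ((1 - b) * y - r * b * z)) / ((1 - b) * (T * D)) := by
    rw [div_sub_div _ _ hT.ne' hDpos.ne', div_eq_div_iff (by positivity) (by positivity)]
    simp only [hDdef, T]
    ring
  have hs0 : 0 ≤ (1 - q) * (1 - b) + r * b :=
    add_nonneg (mul_nonneg (by linarith) hb.le) hrb
  have hs1 : (1 - q) * (1 - b) + r * b ≤ 1 := by nlinarith
  have hnum : |((1 - q) * (1 - b) + r * b) * ((1 - b) * a - q * b * z) -
      q * ((1 - b) * y - r * b * z)| ≤
      |(1 - b) * a - q * b * z| + |(1 - b) * y - r * b * z| := by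
    refine (abs_sub _ _).trans (add_le_add ?_ ?_)
    · rw [abs_mul, abs_of_nonneg hs0]
      exact mul_le_of_le_one_left (abs_nonneg _) hs1
    · rw [abs_mul, abs_of_nonneg hq0]
      exact mul_le_of_le_one_left (abs_nonneg _) (by linarith)
  rw [hid, abs_div, abs_of_pos (by positivity : 0 < (1 - b) * (T * D)),
    div_le_iff₀ (by positivity)]
  have hdev : 0 ≤ deviation b p u d C₀ + deviation b p u l C₀ := by
    linarith [one_le_deviation (b := b) (p := p) u d C₀,
      one_le_deviation (b := b) (p := p) u l C₀]
  calc _ ≤ 4 / ((1 - b) ^ 2 * γ) / n * (deviation b p u d C₀ + deviation b p u l C₀) * T := by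
        linarith
    _ = 4 / ((1 - b) ^ 4 * γ) / n * (deviation b p u d C₀ + deviation b p u l C₀) *
        ((1 - b) * (T * (1 - b))) := by field_simp
    _ ≤ _ := by gcongr

/-- The case in which all other users visit `d`. -/
lemma abs_posterior_sub_le_of_forall (hb0 : 0 ≤ b) (hb1 : b ≤ 1)
    (hp : ∀ v, p v ∈ stdSimplex ℝ Δ) {u : U} {d : Δ}
    (hdet : ∀ v, v ≠ u → ∃ y, p v y = 1) {n : ℕ} (hn : 2 ≤ n)
    (hd : (n : ℝ) - 1 ≤ #(alwaysVisit p u d)) (hx : ∀ x, x ≠ d → alwaysVisit p u x = ∅)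
    {C₀ : Configuration U Δ} (hC₀ : configProb b p C₀ ≠ 0) {o : Bool}
    (hu : C₀ u = (d, false, o)) :
    |posterior b p u d C₀ - p u d / (1 - b + p u d * b)| ≤
      4 / (1 - b) ^ 3 / n * deviation b p u d C₀ := by
  have hin : C₀.input u = false := by simp [Configuration.input, hu]
  have hb : 0 < 1 - b := by linarith [lt_one_of_input_false hb1 hC₀ hin]
  have h1 := abs_cellProb_sub_le hb0 (by linarith) hp hdet hC₀ one_pos hn (by simpa using hd)
  have hT := classProb_pos hb0 hb1 hp hC₀ hin
  have hsum : ∑ x, cellProb b p u C₀ (x, false, true) = cellProb b p u C₀ (d, false, true) :=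
    Fintype.sum_eq_single d fun x hxd => cellProb_eq_zero_of_alwaysVisit_eq_empty hp hdet hC₀
      (hx x hxd) (by rw [hu]; simp [hxd.symm])
  rw [posterior_eq_of_input_false hp hin]
  rw [hsum] at h1 hT ⊢
  have hq0 : 0 ≤ p u d := (hp u).1 d
  have hq1 : p u d ≤ 1 := by
    rw [← (hp u).2]
    exact single_le_sum (fun y _ => (hp u).1 y) (mem_univ d)
  have hn0 : (0 : ℝ) < n := by exact_mod_cast (by omega : 0 < n)
  set a := cellProb b p u C₀ (d, false, true)
  set z := hiddenProb b p u C₀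
  set q := p u d
  set T := a + z
  set D := 1 - b + q * b with hDdef
  have hqb : 0 ≤ q * b := mul_nonneg hq0 hb0
  have hD : 1 - b ≤ D := by linarith
  have hDpos : 0 < D := by linarith
  have hid : (a + q * z) / T - q / D = (1 - q) * ((1 - b) * a - q * b * z) / (T * D) := by
    rw [div_sub_div _ _ hT.ne' hDpos.ne']
    congr 1
    simp only [hDdef, T]
    ring
  rw [hid, abs_div, abs_of_pos (by positivity : 0 < T * D), div_le_iff₀ (by positivity), abs_mul,
    abs_of_nonneg (by linarith : 0 ≤ 1 - q)]
  have hdev : 0 ≤ deviation b p u d C₀ := by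
    linarith [one_le_deviation (b := b) (p := p) u d C₀]
  calc _ ≤ |(1 - b) * a - q * b * z| := mul_le_of_le_one_left (abs_nonneg _) (by linarith)
    _ ≤ _ := h1
    _ = 4 / (1 - b) ^ 3 / n * deviation b p u d C₀ * (T * (1 - b)) := by field_simp
    _ ≤ _ := by gcongr

/-- The case in which no other user visits `d`, and the output of `u` is observed: `u` is the
only user seen at `d`. -/
lemma posterior_eq_one_of_alwaysVisit_eq_empty (hb0 : 0 ≤ b) (hb1 : b ≤ 1)
    (hp : ∀ v, p v ∈ stdSimplex ℝ Δ) {u : U} {d l : Δ} (hdl : d ≠ l)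
    (h : ∀ v, v ≠ u → p v d = 1 ∨ p v l = 1) (hpd : 0 < p u d) (hd : alwaysVisit p u d = ∅)
    {C₀ : Configuration U Δ} (hC₀ : configProb b p C₀ ≠ 0) (hu : C₀ u = (d, false, true)) :
    posterior b p u d C₀ = 1 := by
  have hdet : ∀ v, v ≠ u → ∃ y, p v y = 1 :=
    fun v hv => (h v hv).elim (fun h => ⟨_, h⟩) fun h => ⟨_, h⟩
  have hin : C₀.input u = false := by simp [Configuration.input, hu]
  have hT := classProb_pos hb0 hb1 hp hC₀ hin
  have h1 := cellProb_mul_switch hp hdet hC₀ d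
  have h2 := cellProb_mul_switch hp hdet hC₀ l
  rw [cellProb_false_eq hp] at h1 h2
  change _ = p u d * hiddenProb b p u C₀ * _ at h1
  change _ = p u l * hiddenProb b p u C₀ * _ at h2
  have hz : hiddenProb b p u C₀ = 0 := by
    simpa [unlinkedCount, hd, hu, hpd.ne'] using h1
  have hy : cellProb b p u C₀ (l, false, true) = 0 := by
    have hne : C₀ u ≠ (l, false, true) := by rw [hu]; simp [hdl]
    rw [hz, if_neg hne] at h2
    have hN : (unlinkedCount p u l false C₀ : ℝ) + 1 ≠ 0 := by positivity
    simpa [hN] using h2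
  rw [posterior_eq_of_input_false hp hin]
  rw [sum_cellProb_eq_add hp hdl h hC₀ hu] at hT ⊢
  simp only [hz, hy, mul_zero, add_zero] at hT ⊢
  exact div_self hT.ne'

/-- The case in which no other user visits `d`, and the output of `u` is not observed. -/
lemma abs_posterior_sub_le_of_alwaysVisit_eq_empty (hb0 : 0 ≤ b) (hb1 : b ≤ 1)
    (hp : ∀ v, p v ∈ stdSimplex ℝ Δ) {u : U} {d l : Δ} (hdl : d ≠ l)
    (h : ∀ v, v ≠ u → p v d = 1 ∨ p v l = 1) {n : ℕ} (hn : 2 ≤ n)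
    (hd : alwaysVisit p u d = ∅) (hl : (n : ℝ) - 1 ≤ #(alwaysVisit p u l))
    {C₀ : Configuration U Δ} (hC₀ : configProb b p C₀ ≠ 0) (hu : C₀ u = (d, false, false)) :
    |posterior b p u d C₀ - p u d * (1 - b) / (1 - b + p u l * b)| ≤
      4 / (1 - b) ^ 3 / n * deviation b p u l C₀ := by
  have hdet : ∀ v, v ≠ u → ∃ y, p v y = 1 :=
    fun v hv => (h v hv).elim (fun h => ⟨_, h⟩) fun h => ⟨_, h⟩
  have hin : C₀.input u = false := by simp [Configuration.input, hu]
  have hb : 0 < 1 - b := by linarith [lt_one_of_input_false hb1 hC₀ hin]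
  have h2 := abs_cellProb_sub_le hb0 (by linarith) hp hdet hC₀ one_pos hn (by simpa using hl)
  have hT := classProb_pos hb0 hb1 hp hC₀ hin
  have ha : cellProb b p u C₀ (d, false, true) = 0 :=
    cellProb_eq_zero_of_alwaysVisit_eq_empty hp hdet hC₀ hd (by simp [hu])
  rw [posterior_eq_of_input_false hp hin]
  rw [sum_cellProb_eq_add hp hdl h hC₀ hu, ha, zero_add] at h2 hT ⊢
  rw [zero_add]
  have hq0 : 0 ≤ p u d := (hp u).1 d
  have hr0 : 0 ≤ p u l := (hp u).1 l
  have hq1 : p u d ≤ 1 := by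
    rw [← (hp u).2]
    exact single_le_sum (fun y _ => (hp u).1 y) (mem_univ d)
  have hn0 : (0 : ℝ) < n := by exact_mod_cast (by omega : 0 < n)
  set y := cellProb b p u C₀ (l, false, true)
  set z := hiddenProb b p u C₀
  set q := p u d
  set r := p u l
  set T := y + z
  set D := 1 - b + r * b with hDdef
  have hrb : 0 ≤ r * b := mul_nonneg hr0 hb0
  have hD : 1 - b ≤ D := by linarith
  have hDpos : 0 < D := by linarith
  have hid : q * z / T - q * (1 - b) / D = -(q * ((1 - b) * y - r * b * z)) / (T * D) := by
    rw [div_sub_div _ _ hT.ne' hDpos.ne']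
    congr 1
    simp only [hDdef, T]
    ring
  rw [hid, abs_div, abs_of_pos (by positivity : 0 < T * D), div_le_iff₀ (by positivity), abs_neg,
    abs_mul, abs_of_nonneg hq0]
  have hdev : 0 ≤ deviation b p u l C₀ := by
    linarith [one_le_deviation (b := b) (p := p) u l C₀]
  calc _ ≤ |(1 - b) * y - r * b * z| := mul_le_of_le_one_left (abs_nonneg _) hq1
    _ ≤ _ := h2
    _ = 4 / (1 - b) ^ 3 / n * deviation b p u l C₀ * (T * (1 - b)) := by field_simp
    _ ≤ _ := by gcongr

end

/-- If no other user visits `d`, the exit of `u` at `d` identifies it. -/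
lemma abs_expectedPosterior_sub_le_of_fraction_zero {U Δ : Type*} [Fintype U] [Fintype Δ] {b : ℝ}
    {p : U → Δ → ℝ} (hb0 : 0 ≤ b) (hb1 : b ≤ 1)
    (hp : ∀ v, p v ∈ stdSimplex ℝ Δ) {u : U} {d l : Δ} (hpd : 0 < p u d)
    (h : ∀ v, v ≠ u → p v d = 1 ∨ p v l = 1) {n : ℕ} (hn : Fintype.card U = n) (hn2 : 2 ≤ n)
    (hα : fractionAlways p u d = 0) :
    |expectedPosterior b p u d - (b * (1 - b) * p u d + b ^ 2 +
        (1 - b) * (b + (1 - b) ^ 2 * p u d / (1 - b + p u l * b)))| ≤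
      12 * (4 / (1 - b) ^ 3) / p u d * Real.sqrt (Real.log n / n) := by
  have hn' : (2 : ℝ) ≤ n := by exact_mod_cast hn2
  have hcard := card_sub_one_le_card_alwaysVisit_add h
  rw [fractionAlways_eq, hn, div_eq_zero_iff, or_iff_left (by linarith)] at hα
  have hd : #(alwaysVisit p u d) = 0 := by exact_mod_cast hα
  have hdl : d ≠ l := by
    rintro rfl
    omega
  have hl : (n : ℝ) - 1 ≤ #(alwaysVisit p u l) := by
    rw [sub_le_iff_le_add]
    exact_mod_cast (by omega : n ≤ #(alwaysVisit p u l) + 1)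
  have hb : 0 ≤ 1 - b := by linarith
  have hmain := abs_expectedPosterior_sub_le_sqrt hb0 hb1 hp hpd l hn hn2
    (fun o => bif o then 1 else p u d * (1 - b) / (1 - b + p u l * b))
    (c := 4 / (1 - b) ^ 3) (by positivity) (by
      intro C o hC hu
      have h1 := one_le_deviation (b := b) (p := p) u d C
      have h2 := one_le_deviation (b := b) (p := p) u l C
      cases o
      · refine (abs_posterior_sub_le_of_alwaysVisit_eq_empty hb0 hb1 hp hdl h hn2
          (card_eq_zero.1 hd) hl hC hu).trans ?_
        exact mul_le_mul_of_nonneg_left (by linarith) (by positivity)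
      · rw [posterior_eq_one_of_alwaysVisit_eq_empty hb0 hb1 hp hdl h hpd (card_eq_zero.1 hd) hC
          hu]
        simp only [cond_true, sub_self, abs_zero]
        exact mul_nonneg (by positivity) (by linarith))
  convert hmain using 3
  simp only [cond_true, cond_false]
  ring

lemma abs_expectedPosterior_sub_le_of_fraction_mixed {U Δ : Type*} [Fintype U] [Fintype Δ] {b : ℝ}
    {p : U → Δ → ℝ} (hb0 : 0 ≤ b) (hb1 : b ≤ 1)
    (hp : ∀ v, p v ∈ stdSimplex ℝ Δ) {u : U} {d l : Δ} (hpd : 0 < p u d)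
    (h : ∀ v, v ≠ u → p v d = 1 ∨ p v l = 1) {n : ℕ} (hn : Fintype.card U = n) (hn2 : 2 ≤ n)
    {α : ℝ} (hα : fractionAlways p u d = α) (hα0 : 0 < α) (hα1 : α < 1) :
    |expectedPosterior b p u d - (b * (1 - b) * p u d + b ^ 2 +
        (1 - b) * (p u d / (1 - b + p u d * b + p u l * b)))| ≤
      12 * (4 / ((1 - b) ^ 4 * min α (1 - α))) / p u d * Real.sqrt (Real.log n / n) := by
  have hn' : (2 : ℝ) ≤ n := by exact_mod_cast hn2
  have hcard := card_sub_one_le_card_alwaysVisit_add h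
  rw [fractionAlways_eq, hn, div_eq_iff (by linarith)] at hα
  have hdl : d ≠ l := by
    rintro rfl
    classical
    have hall : ∀ v, v ≠ u → p v d = 1 := fun v hv => (h v hv).elim id id
    have hle : (n : ℝ) - 1 ≤ #(alwaysVisit p u d) := by
      have : alwaysVisit p u d = univ.erase u := by
        ext v
        simp only [alwaysVisit, mem_filter, mem_univ, true_and, mem_erase, and_true]
        exact ⟨fun h => h.1, fun hv => ⟨hv, hall v hv⟩⟩
      rw [this, card_erase_of_mem (mem_univ u), card_univ, hn, sub_le_iff_le_add]
      exact_mod_cast (by omega : n ≤ n - 1 + 1)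
    nlinarith
  have hl : (1 - α) * ((n : ℝ) - 1) ≤ #(alwaysVisit p u l) := by
    have : (n : ℝ) ≤ #(alwaysVisit p u d) + #(alwaysVisit p u l) + 1 := by
      exact_mod_cast (by omega : n ≤ #(alwaysVisit p u d) + #(alwaysVisit p u l) + 1)
    linarith
  have hγ : 0 < min α (1 - α) := lt_min hα0 (by linarith)
  have hmain := abs_expectedPosterior_sub_le_sqrt hb0 hb1 hp hpd l hn hn2
    (fun _ => p u d / (1 - b + p u d * b + p u l * b))
    (c := 4 / ((1 - b) ^ 4 * min α (1 - α))) (by positivity) (by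
      intro C o hC hu
      refine abs_posterior_sub_le_of_mixed hb0 hb1 hp hdl h hγ hn2 ?_ ?_ hC hu
      · rw [hα]
        exact mul_le_mul_of_nonneg_right (min_le_left _ _) (by linarith)
      · exact (mul_le_mul_of_nonneg_right (min_le_right _ _) (by linarith)).trans hl)
  convert hmain using 3
  ring

lemma abs_expectedPosterior_sub_le_of_fraction_one {U Δ : Type*} [Fintype U] [Fintype Δ] {b : ℝ}
    {p : U → Δ → ℝ} (hb0 : 0 ≤ b) (hb1 : b ≤ 1)
    (hp : ∀ v, p v ∈ stdSimplex ℝ Δ) {u : U} {d : Δ} (hpd : 0 < p u d)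
    (hdet : ∀ v, v ≠ u → ∃ y, p v y = 1) {n : ℕ} (hn : Fintype.card U = n) (hn2 : 2 ≤ n)
    (hα : fractionAlways p u d = 1) :
    |expectedPosterior b p u d - (b * (1 - b) * p u d + b ^ 2 +
        (1 - b) * (p u d / (1 - b + p u d * b)))| ≤
      12 * (4 / (1 - b) ^ 3) / p u d * Real.sqrt (Real.log n / n) := by
  have hn' : (2 : ℝ) ≤ n := by exact_mod_cast hn2
  rw [fractionAlways_eq, hn, div_eq_iff (by linarith), one_mul] at hα
  have hd : n = #(alwaysVisit p u d) + 1 := by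
    rw [eq_sub_iff_add_eq] at hα
    exact_mod_cast hα.symm
  have hx : ∀ x, x ≠ d → alwaysVisit p u x = ∅ := by
    intro x hxd
    have := card_alwaysVisit_add_le hp u hxd
    exact card_eq_zero.1 (by omega)
  have hb : 0 ≤ 1 - b := by linarith
  have hmain := abs_expectedPosterior_sub_le_sqrt hb0 hb1 hp hpd d hn hn2
    (fun _ => p u d / (1 - b + p u d * b)) (c := 4 / (1 - b) ^ 3) (by positivity) (by
      intro C o hC hu
      have h1 := one_le_deviation (b := b) (p := p) u d C
      refine (abs_posterior_sub_le_of_forall hb0 hb1 hp hdet hn2 hα.ge hx hC hu).trans ?_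
      exact mul_le_mul_of_nonneg_left (by linarith) (by positivity))
  convert hmain using 3
  ring

end OnionRouting

theorem mainTheorem4
    {Δ : Type*} [Fintype Δ]
    (b : ℝ) (hb0 : 0 ≤ b) (hb1 : b ≤ 1)
    -- the destinations `d = δ 0, δ 1, …, δ m`, and the destination distribution of `u`
    (m : ℕ) (δ : Fin (m + 1) ≃ Δ)
    (pu : Δ → ℝ) (hpu : pu ∈ stdSimplex ℝ Δ) (hd : 0 < pu (δ 0))
    (hord : ∀ i j : Fin (m + 1), 0 < i → i ≤ j → pu (δ j) ≤ pu (δ i))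
    (α : ℝ) :
    ∃ K : ℝ, ∀ (U : Type*) [Fintype U] (n : ℕ), Fintype.card U = n → 2 ≤ n →
      ∀ (u : U) (p : U → Δ → ℝ),
        (∀ v, p v ∈ stdSimplex ℝ Δ) → p u = pu →
        (∀ v, v ≠ u → p v (δ 0) = 1 ∨ p v (δ (Fin.last m)) = 1) →
        OnionRouting.fractionAlways p u (δ 0) = α →
        (α = 0 →
          |OnionRouting.expectedPosterior b p u (δ 0) -
            (b * (1 - b) * pu (δ 0) + b ^ 2 +
              (1 - b) * (b + (1 - b) ^ 2 * pu (δ 0) / (1 - b + pu (δ (Fin.last m)) * b)))|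
            ≤ K * Real.sqrt (Real.log n / n)) ∧
        (0 < α → α < 1 →
          |OnionRouting.expectedPosterior b p u (δ 0) -
            (b * (1 - b) * pu (δ 0) + b ^ 2 +
              (1 - b) * (pu (δ 0) / (1 - b + pu (δ 0) * b + pu (δ (Fin.last m)) * b)))|
            ≤ K * Real.sqrt (Real.log n / n)) ∧
        (α = 1 →
          |OnionRouting.expectedPosterior b p u (δ 0) -
            (b * (1 - b) * pu (δ 0) + b ^ 2 +
              (1 - b) * (pu (δ 0) / (1 - b + pu (δ 0) * b)))|
            ≤ K * Real.sqrt (Real.log n / n)) := by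
  -- The maximum selects the constant of the relevant case: for `α` outside `(0, 1)` the second one
  -- is not positive. For `b = 1` both vanish by division by `0`, as they may: all inputs and
  -- outputs are then observed and the error is `0`.
  refine ⟨max (12 * (4 / (1 - b) ^ 3) / pu (δ 0))
    (12 * (4 / ((1 - b) ^ 4 * min α (1 - α))) / pu (δ 0)), ?_⟩
  intro U _ n hn hn2 u p hp hu h hα
  subst hu
  have hs : 0 ≤ Real.sqrt (Real.log n / n) := Real.sqrt_nonneg _
  have hdet : ∀ v, v ≠ u → ∃ y, p v y = 1 :=
    fun v hv => (h v hv).elim (fun h => ⟨_, h⟩) fun h => ⟨_, h⟩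
  refine ⟨fun h0 => ?_, fun h0 h1 => ?_, fun h1 => ?_⟩
  · exact (OnionRouting.abs_expectedPosterior_sub_le_of_fraction_zero hb0 hb1 hp hd h hn hn2
      (hα.trans h0)).trans (mul_le_mul_of_nonneg_right (le_max_left _ _) hs)
  · exact (OnionRouting.abs_expectedPosterior_sub_le_of_fraction_mixed hb0 hb1 hp hd h hn hn2
      hα h0 h1).trans (mul_le_mul_of_nonneg_right (le_max_right _ _) hs)
  · exact (OnionRouting.abs_expectedPosterior_sub_le_of_fraction_one hb0 hb1 hp hd hdet hn hn2
      (hα.trans h1)).trans (mul_le_mul_of_nonneg_right (le_max_left _ _) hs)
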